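/- Let $f:\mathbb R^{p_1\times p_2}\to\mathbb R$ be differentiable, let $\langle A,B\rangle=\operatorname{tr}(A^{\top}B)$, and let $\|\cdot\|_F$ be the Frobenius norm. For $k\in\mathbb N$ say that $f$ satisfies rank-restricted strong convexity (RSC) at level $k$ with constant $\alpha$, respectively rank-restricted strong smoothness (RSS) at level $k$ with constant $L$, if for all $s_1,s_2\in\mathbb N$ with $s_1+s_2=k$ and all $W_1,W_2$ with $\operatorname{rank}(W_1)\le s_1$, $\operatorname{rank}(W_2)\le s_2$, $$f(W_1)-f(W_2)\ \ge\ \langle W_1-W_2,\nabla f(W_2)\rangle+\tfrac{\alpha}{2}\|W_1-W_2\|_F^2,$$ respectively $$f(W_1)-f(W_2)\ \le\ \langle W_1-W_2,\nabla f(W_2)\rangle+\tfrac{L}{2}\|W_1-W_2\|_F^2 .$$ For a matrix $W$ with singular value decomposition $W=U\Sigma V^{\top}$ (singular values in nonincreasing order), let $PM_s(W)=U_s\Sigma_sV_s^{\top}$ be its truncation to the top $s$ singular values and vectors (if the decomposition is not unique, any choice is allowed). **Theorem.** There is an absolute constant $C>0$ with the following property. Let $r,s\in\mathbb N$ and let $f$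 satisfy RSC and RSS at level $2s+r$ with constants $\alpha>0$ and $L>0$, respectively, where $s\ge 32\,(L/\alpha)^2\,r$. Let $W^*$ be a minimizer of $f$ over $\{W:\operatorname{rank}(W)\le r\}$. Let $W^0=0$ and $$W^{t+1}=PM_s\bigl(W^t-\eta\nabla f(W^t)\bigr),\qquad \eta=\frac{2}{3L},\qquad t=0,1,2,\dots$$ Then, for every $\varepsilon>0$ and every integer $\tau\ge 0$ with $$\tau\ \ge\ C\,\frac{L}{\alpha}\,\log\frac{f(W^0)-f(W^*)}{\varepsilon},$$ we have $f(W^\tau)-f(W^*)\le\varepsilon$. (If $f(W^0)=f(W^*)$, this holds for every $\tau\ge 0$.) In particular, if $f(W^*)\ge 0$, then $f(W^\tau)-f(W^*)\le\varepsilon$ holds for every integer $\tau\ge0$ with $\tau\ge C\,\frac{L}{\alpha}\,\log\frac{f(W^0)}{\varepsilon}$ (for every $\tau\ge0$ if $f(W^0)=0$). -/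

import Mathlib

open scoped Matrix Matrix.Norms.Frobenius

namespace LowRankPGD

noncomputable section

/-- The trace (Frobenius) inner product `⟨A, B⟩ = tr(Aᵀ B)` of real matrices. -/
def matInner {p₁ p₂ : ℕ} (A B : Matrix (Fin p₁) (Fin p₂) ℝ) : ℝ :=
  (Aᵀ * B).trace

/-- The gradient matrix of `f : ℝ^{p₁ × p₂} → ℝ` at `W`, whose `(i, j)` entry is the partial
derivative of `f` at `W` in the direction of the `(i, j)` matrix unit. -/
def matGrad {p₁ p₂ : ℕ} (f : Matrix (Fin p₁) (Fin p₂) ℝ → ℝ) (W : Matrix (Fin p₁) (Fin p₂) ℝ) :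
    Matrix (Fin p₁) (Fin p₂) ℝ :=
  Matrix.of fun i j => fderiv ℝ f W (Matrix.single i j 1)

/-- Restricted strong convexity at rank level `k` with constant `α`: the strong convexity
inequality holds for all pairs of matrices of ranks at most `s₁` and `s₂`, for every splitting
`k = s₁ + s₂`. The norm is the Frobenius norm. -/
def RankRSC {p₁ p₂ : ℕ} (f : Matrix (Fin p₁) (Fin p₂) ℝ → ℝ) (k : ℕ) (α : ℝ) : Prop :=
  ∀ s₁ s₂ : ℕ, s₁ + s₂ = k → ∀ W₁ W₂ : Matrix (Fin p₁) (Fin p₂) ℝ,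
    W₁.rank ≤ s₁ → W₂.rank ≤ s₂ →
      f W₁ - f W₂ ≥ matInner (W₁ - W₂) (matGrad f W₂) + α / 2 * ‖W₁ - W₂‖ ^ 2

/-- Restricted strong smoothness at rank level `k` with constant `L`. -/
def RankRSS {p₁ p₂ : ℕ} (f : Matrix (Fin p₁) (Fin p₂) ℝ → ℝ) (k : ℕ) (L : ℝ) : Prop :=
  ∀ s₁ s₂ : ℕ, s₁ + s₂ = k → ∀ W₁ W₂ : Matrix (Fin p₁) (Fin p₂) ℝ,
    W₁.rank ≤ s₁ → W₂.rank ≤ s₂ →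
      f W₁ - f W₂ ≤ matInner (W₁ - W₂) (matGrad f W₂) + L / 2 * ‖W₁ - W₂‖ ^ 2

/-- The `p₁ × p₂` rectangular diagonal matrix with diagonal entries `σ 0, σ 1, …`. -/
def rectDiag (p₁ p₂ : ℕ) (σ : ℕ → ℝ) : Matrix (Fin p₁) (Fin p₂) ℝ :=
  Matrix.of fun i j => if (i : ℕ) = (j : ℕ) then σ i else 0

/-- `W = U Σ Vᵀ` is a (full) singular value decomposition of `W`: `U`, `V` are orthogonal, and `Σ`
is rectangular diagonal with nonnegative nonincreasing diagonal entries. -/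
structure IsSVD {p₁ p₂ : ℕ} (W : Matrix (Fin p₁) (Fin p₂) ℝ)
    (U : Matrix (Fin p₁) (Fin p₁) ℝ) (σ : ℕ → ℝ) (V : Matrix (Fin p₂) (Fin p₂) ℝ) : Prop where
  orthogonal_left : U ∈ Matrix.orthogonalGroup (Fin p₁) ℝ
  orthogonal_right : V ∈ Matrix.orthogonalGroup (Fin p₂) ℝ
  nonneg : ∀ i, 0 ≤ σ i
  antitone : Antitone σ
  eq_mul : W = U * rectDiag p₁ p₂ σ * Vᵀ

/-- `Z` is a value of the rank-`s` SVD truncation `PM_s(W) = U_s Σ_s V_sᵀ`: for some singular value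
decomposition `W = U Σ Vᵀ`, the matrix `Z` is obtained by keeping the top `s` singular values (with
their singular vectors) and replacing the other ones by zero. This is a relation, as the
truncation depends on the chosen decomposition when the `s`-th and `(s+1)`-st singular values
coincide. -/
def IsSVDTruncation {p₁ p₂ : ℕ} (s : ℕ) (W Z : Matrix (Fin p₁) (Fin p₂) ℝ) : Prop :=
  ∃ U σ V, IsSVD W U σ V ∧ Z = U * rectDiag p₁ p₂ (fun i => if i < s then σ i else 0) * Vᵀ

/-- `W 0, W 1, W 2, …` are the iterates of projected gradient descent for `f` with rank-`s` SVD
truncation and step size `η`, started at the zero matrix. -/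
structure IsPGD {p₁ p₂ : ℕ} (f : Matrix (Fin p₁) (Fin p₂) ℝ → ℝ) (s : ℕ) (η : ℝ)
    (W : ℕ → Matrix (Fin p₁) (Fin p₂) ℝ) : Prop where
  zero : W 0 = 0
  step : ∀ t, IsSVDTruncation s (W t - η • matGrad f (W t)) (W (t + 1))

end

end LowRankPGD

/-!
The proof rests on one property of the truncation `y` of a matrix `z` to its top `s` singular
values: a matrix `w` of rank at most `r`, where `r ≤ c² s` and `0 < c ≤ 1`, satisfies
`⟨w - y, z - y⟩ ≤ (c / 2) ‖w - y‖²` (`matInner_sub_truncation_le`). The truncation thus behaves like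
a projection onto a convex set, up to an error that is small when `s` is much larger than `r`; for
`c = 1` this is the Eckart–Young theorem. It is proved in coordinates in which `z` is diagonal, with
the orthogonal projection `P` onto the column space of `w`: the part of `z - y` inside that space is
controlled by the part of `y` outside of it, because `P` has trace at most `r` and diagonal entries
in `[0, 1]`.

Now let `y` be the iterate after `x`, and put `Δ = f x - f w`, `Δ' = f y - f w` for `w = W*`. The
property with `c = 1` against `x` and restricted smoothness give `(L / 4) ‖y - x‖² ≤ Δ - Δ'`. The
property with `c = α / (5 L)` against `w`, restricted smoothness and restricted strong convexity
give `Δ' ≤ (3L/4 - α/2) ‖x - w‖² - (3L/4 - 3α/20) ‖y - w‖²`. The first coefficient is smaller than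
the second one by a multiple of `α`, so the right-hand side is at most a multiple of
`(L² / α) ‖y - x‖²`, whence `Δ' ≤ 12 (L / α) (Δ - Δ')` (`gap_step_le`). This is a contraction of the
gap by the factor `12 κ / (1 + 12 κ)` with `κ = L / α`, in each step and whatever the sign of the gap.
-/

namespace LowRankPGD

variable {p₁ p₂ : ℕ}

/-! ### The Frobenius inner product -/

lemma matInner_comm (A B : Matrix (Fin p₁) (Fin p₂) ℝ) : matInner A B = matInner B A := by
  unfold matInner
  rw [← Matrix.trace_transpose, Matrix.transpose_mul, Matrix.transpose_transpose]

lemma matInner_sub_left (A B C : Matrix (Fin p₁) (Fin p₂) ℝ) :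
    matInner (A - B) C = matInner A C - matInner B C := by
  simp [matInner, Matrix.sub_mul]

lemma matInner_sub_right (A B C : Matrix (Fin p₁) (Fin p₂) ℝ) :
    matInner A (B - C) = matInner A B - matInner A C := by
  simp [matInner, Matrix.mul_sub]

lemma matInner_smul_right (a : ℝ) (A B : Matrix (Fin p₁) (Fin p₂) ℝ) :
    matInner A (a • B) = a * matInner A B := by
  simp [matInner]

lemma matInner_smul_left (a : ℝ) (A B : Matrix (Fin p₁) (Fin p₂) ℝ) :
    matInner (a • A) B = a * matInner A B := by
  simp [matInner]

lemma norm_sq_eq_matInner (A : Matrix (Fin p₁) (Fin p₂) ℝ) : ‖A‖ ^ 2 = matInner A A := by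
  have h : 0 ≤ ∑ i, ∑ j, ‖A i j‖ ^ (2 : ℝ) := by positivity
  rw [Matrix.frobenius_norm_def, ← Real.rpow_natCast, ← Real.rpow_mul h]
  norm_num [matInner, Matrix.trace, Matrix.mul_apply]
  rw [Finset.sum_comm]
  simp only [sq]

lemma matInner_self_nonneg (A : Matrix (Fin p₁) (Fin p₂) ℝ) : 0 ≤ matInner A A := by
  rw [← norm_sq_eq_matInner]; positivity

lemma matInner_mul_left (P : Matrix (Fin p₁) (Fin p₁) ℝ) (A B : Matrix (Fin p₁) (Fin p₂) ℝ) :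
    matInner (P * A) B = matInner A (Pᵀ * B) := by
  simp [matInner, Matrix.mul_assoc]

lemma matInner_orthogonal_conj {U : Matrix (Fin p₁) (Fin p₁) ℝ} {V : Matrix (Fin p₂) (Fin p₂) ℝ}
    (hU : U ∈ Matrix.orthogonalGroup (Fin p₁) ℝ) (hV : V ∈ Matrix.orthogonalGroup (Fin p₂) ℝ)
    (A B : Matrix (Fin p₁) (Fin p₂) ℝ) :
    matInner (U * A * Vᵀ) (U * B * Vᵀ) = matInner A B := by
  have hU' : Uᵀ * U = 1 := (Matrix.mem_orthogonalGroup_iff' (Fin p₁) ℝ).1 hU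
  have hV' : Vᵀ * V = 1 := (Matrix.mem_orthogonalGroup_iff' (Fin p₂) ℝ).1 hV
  unfold matInner
  have : (U * A * Vᵀ)ᵀ * (U * B * Vᵀ) = V * (Aᵀ * (Uᵀ * U) * B * Vᵀ) := by
    simp [Matrix.transpose_mul, Matrix.mul_assoc]
  rw [this, Matrix.trace_mul_comm, hU', Matrix.mul_one, Matrix.mul_assoc, hV', Matrix.mul_one]

/-! ### Projection onto the column space -/

/-- The orthogonal projection onto the column space of `w`, as a matrix. -/
lemma exists_columnSpace_projection (w : Matrix (Fin p₁) (Fin p₂) ℝ) :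
    ∃ P : Matrix (Fin p₁) (Fin p₁) ℝ,
      Pᵀ = P ∧ P * P = P ∧ P * w = w ∧ P.trace = w.rank := by
  -- `P` is the spectral projection of `w wᵀ` onto its nonzero eigenvalues.
  have hA : (w * wᵀ).IsHermitian := by
    simpa using Matrix.isHermitian_mul_conjTranspose_self w
  obtain ⟨U, hUdef⟩ : ∃ U : Matrix (Fin p₁) (Fin p₁) ℝ, U = hA.eigenvectorUnitary.1 := ⟨_, rfl⟩
  have hU : Uᵀ * U = 1 := by
    rw [hUdef]
    exact (Matrix.mem_orthogonalGroup_iff' (Fin p₁) ℝ).1 hA.eigenvectorUnitary.2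
  have hspec : w * wᵀ = U * Matrix.diagonal hA.eigenvalues * Uᵀ := by
    have h := hA.spectral_theorem
    rw [Unitary.conjStarAlgAut_apply] at h
    simpa [Matrix.star_eq_conjTranspose, Function.comp_def, hUdef] using h
  set e : Fin p₁ → ℝ := fun i => if hA.eigenvalues i = 0 then 0 else 1 with he
  have hdiag : ∀ a b : Fin p₁ → ℝ, U * Matrix.diagonal a * Uᵀ * (U * Matrix.diagonal b * Uᵀ)
      = U * Matrix.diagonal (fun i => a i * b i) * Uᵀ := by
    intro a b
    rw [← Matrix.diagonal_mul_diagonal]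
    calc _ = U * Matrix.diagonal a * (Uᵀ * U) * Matrix.diagonal b * Uᵀ := by
          simp only [Matrix.mul_assoc]
      _ = _ := by rw [hU]; simp only [Matrix.mul_assoc, Matrix.one_mul]
  have hsymm : (U * Matrix.diagonal e * Uᵀ)ᵀ = U * Matrix.diagonal e * Uᵀ := by
    simp [Matrix.mul_assoc]
  refine ⟨U * Matrix.diagonal e * Uᵀ, hsymm, ?_, ?_, ?_⟩
  · rw [hdiag]
    congr 3
    ext i
    simp [he]
  · have h1 : U * Matrix.diagonal e * Uᵀ * (w * wᵀ) = w * wᵀ := by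
      rw [hspec, hdiag]
      congr 3
      ext i
      by_cases h : hA.eigenvalues i = 0 <;> simp [he, h]
    -- `(P w - w) (P w - w)ᵀ = 0` forces `P w = w`.
    have h2 : (U * Matrix.diagonal e * Uᵀ * w - w) * (U * Matrix.diagonal e * Uᵀ * w - w)ᴴ = 0 := by
      rw [Matrix.conjTranspose_eq_transpose_of_trivial, Matrix.transpose_sub, Matrix.mul_sub,
        Matrix.transpose_mul, ← Matrix.mul_assoc, Matrix.sub_mul,
        Matrix.mul_assoc _ w wᵀ, h1, sub_self, Matrix.zero_mul, sub_self]
    exact sub_eq_zero.1 (Matrix.self_mul_conjTranspose_eq_zero.1 h2)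
  · rw [Matrix.trace_mul_comm, ← Matrix.mul_assoc, hU, Matrix.one_mul, Matrix.trace_diagonal]
    have hr : w.rank = (w * wᵀ).rank := by
      simp
    rw [hr, hA.rank_eq_card_non_zero_eigs, Fintype.card_subtype]
    simp [he, Finset.sum_ite]

/-! ### Truncation of rectangular diagonal matrices -/

lemma rectDiag_mul_transpose (σ ρ : ℕ → ℝ) :
    rectDiag p₁ p₂ σ * (rectDiag p₁ p₂ ρ)ᵀ
      = Matrix.diagonal fun i : Fin p₁ => if (i : ℕ) < p₂ then σ i * ρ i else 0 := by
  ext i j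
  simp only [rectDiag, Matrix.mul_apply, Matrix.transpose_apply, Matrix.of_apply,
    Matrix.diagonal_apply]
  by_cases hi : (i : ℕ) < p₂
  · rw [Finset.sum_eq_single (⟨i, hi⟩ : Fin p₂)]
    · by_cases hij : i = j
      · subst hij; simp [hi]
      · have : (j : ℕ) ≠ i := fun h => hij (Fin.ext h.symm)
        simp [hij, this]
    · intro k _ hk
      have : (i : ℕ) ≠ k := fun h => hk (Fin.ext h.symm)
      simp [this]
    · simp
  · have : ∀ k : Fin p₂, (i : ℕ) ≠ k := fun k h => hi (h ▸ k.2)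
    simp [this, hi]

/-- The part of a diagonal matrix that truncation drops is, inside a space of dimension at most
`c² s`, no larger than `c` times the part outside this space of what truncation keeps. -/
lemma sum_tail_le_sum_head {c : ℝ} (hc : 0 < c) (hc1 : c ≤ 1) {s : ℕ} {σ : ℕ → ℝ}
    (hσ : ∀ i, 0 ≤ σ i) (hanti : Antitone σ) {q : Fin p₁ → ℝ} (hq0 : ∀ i, 0 ≤ q i)
    (hq1 : ∀ i, q i ≤ 1) (hq : ∑ i, q i ≤ c ^ 2 * s) :
    ∑ i : Fin p₁, q i * (if (i : ℕ) < p₂ then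
        (if (i : ℕ) < s then 0 else σ i) * (if (i : ℕ) < s then 0 else σ i) else 0)
      ≤ c ^ 2 * ∑ i : Fin p₁, (1 - q i) * (if (i : ℕ) < p₂ then
        (if (i : ℕ) < s then σ i else 0) * (if (i : ℕ) < s then σ i else 0) else 0) := by
  by_cases hs : s < p₁ ∧ s < p₂
  · have hcard : ∑ i : Fin p₁, (if (i : ℕ) < s then c ^ 2 else 0) = c ^ 2 * s := by
      rw [Fin.sum_univ_eq_sum_range (fun i => if i < s then c ^ 2 else 0), Finset.sum_ite,
        Finset.sum_const_zero, add_zero, Finset.sum_const, nsmul_eq_mul]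
      have : {i ∈ Finset.range p₁ | i < s} = Finset.range s := by
        ext i; simp only [Finset.mem_filter, Finset.mem_range]; omega
      rw [this, Finset.card_range, mul_comm]
    have key : σ s ^ 2 * ∑ i : Fin p₁, ((if (i : ℕ) < s then c ^ 2 else 0) - q i)
        ≤ ∑ i : Fin p₁, (c ^ 2 * ((1 - q i) * (if (i : ℕ) < p₂ then
            (if (i : ℕ) < s then σ i else 0) * (if (i : ℕ) < s then σ i else 0) else 0))
          - q i * (if (i : ℕ) < p₂ then
            (if (i : ℕ) < s then 0 else σ i) * (if (i : ℕ) < s then 0 else σ i) else 0)) := by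
      rw [Finset.mul_sum]
      refine Finset.sum_le_sum fun i _ => ?_
      by_cases hi : (i : ℕ) < s
      · have h1 : σ s ^ 2 ≤ σ i ^ 2 := pow_le_pow_left₀ (hσ s) (hanti hi.le) 2
        have h2 : c ^ 2 - q i ≤ c ^ 2 * (1 - q i) := by
          have : c ^ 2 ≤ 1 := pow_le_one₀ hc.le hc1
          nlinarith [hq0 i]
        have h3 : 0 ≤ c ^ 2 * (1 - q i) := mul_nonneg (sq_nonneg c) (sub_nonneg.2 (hq1 i))
        simp only [hi, hi.trans hs.2, if_true]
        calc σ s ^ 2 * (c ^ 2 - q i) ≤ σ s ^ 2 * (c ^ 2 * (1 - q i)) :=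
              mul_le_mul_of_nonneg_left h2 (sq_nonneg _)
          _ ≤ σ i ^ 2 * (c ^ 2 * (1 - q i)) := mul_le_mul_of_nonneg_right h1 h3
          _ = _ := by ring
      · have h1 : σ i ^ 2 ≤ σ s ^ 2 := pow_le_pow_left₀ (hσ i) (hanti (not_lt.1 hi)) 2
        by_cases hp : (i : ℕ) < p₂ <;> simp only [hi, hp, if_true, if_false] <;>
          nlinarith [hq0 i, mul_le_mul_of_nonneg_left h1 (hq0 i), sq_nonneg (σ s),
            mul_nonneg (hq0 i) (sq_nonneg (σ s))]
    rw [Finset.sum_sub_distrib, Finset.sum_sub_distrib, hcard, ← Finset.mul_sum] at key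
    nlinarith [mul_nonneg (sq_nonneg (σ s)) (sub_nonneg.2 hq)]
  · -- Nothing is dropped if `s` is at least one of the dimensions.
    have h0 : ∀ i : Fin p₁, (i : ℕ) < p₂ → (i : ℕ) < s := fun i hi => by
      have := i.2
      omega
    rw [Finset.sum_eq_zero]
    · refine mul_nonneg (sq_nonneg c) (Finset.sum_nonneg fun i _ =>
        mul_nonneg (sub_nonneg.2 (hq1 i)) ?_)
      split_ifs
      · exact mul_self_nonneg _
      · simp
      · exact le_rfl
    · intro i _
      by_cases hp : (i : ℕ) < p₂
      · simp [h0 i hp]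
      · simp [hp]

lemma matInner_projection_rectDiag {P : Matrix (Fin p₁) (Fin p₁) ℝ} (hPt : Pᵀ = P)
    (σ ρ : ℕ → ℝ) :
    matInner (P * rectDiag p₁ p₂ σ) (rectDiag p₁ p₂ ρ)
      = ∑ i, P i i * (if (i : ℕ) < p₂ then ρ i * σ i else 0) := by
  unfold matInner
  rw [Matrix.transpose_mul, hPt, Matrix.mul_assoc, Matrix.trace_mul_comm, Matrix.mul_assoc,
    rectDiag_mul_transpose]
  simp [Matrix.trace, Matrix.mul_diagonal]

/-- The case of a diagonal matrix in `matInner_sub_truncation_le`. -/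
lemma matInner_sub_rectDiag_le {c : ℝ} (hc : 0 < c) (hc1 : c ≤ 1) {s : ℕ} {σ : ℕ → ℝ}
    (hσ : ∀ i, 0 ≤ σ i) (hanti : Antitone σ) {w : Matrix (Fin p₁) (Fin p₂) ℝ}
    (hw : (w.rank : ℝ) ≤ c ^ 2 * s) :
    matInner (w - rectDiag p₁ p₂ fun i => if i < s then σ i else 0)
        (rectDiag p₁ p₂ σ - rectDiag p₁ p₂ fun i => if i < s then σ i else 0)
      ≤ c / 2 * ‖w - rectDiag p₁ p₂ fun i => if i < s then σ i else 0‖ ^ 2 := by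
  obtain ⟨P, hPt, hPP, hPw, hPtr⟩ := exists_columnSpace_projection w
  have hPii : ∀ i, P i i = ∑ j, P i j ^ 2 := fun i => by
    conv_lhs => rw [← hPP, Matrix.mul_apply]
    refine Finset.sum_congr rfl fun j _ => ?_
    rw [sq, ← Matrix.transpose_apply P i j, hPt]
  have hP0 : ∀ i, 0 ≤ P i i := fun i => by rw [hPii]; positivity
  have hP1 : ∀ i, P i i ≤ 1 := fun i => by
    have : P i i ^ 2 ≤ P i i := by
      conv_rhs => rw [hPii]
      exact Finset.single_le_sum (f := fun j => P i j ^ 2) (fun j _ => sq_nonneg _)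
        (Finset.mem_univ i)
    nlinarith [hP0 i]
  set T := rectDiag p₁ p₂ fun i => if i < s then σ i else 0 with hT
  set R := rectDiag p₁ p₂ fun i => if i < s then 0 else σ i with hR
  have hDT : rectDiag p₁ p₂ σ - T = R := by
    ext i j
    simp only [hT, hR, rectDiag, Matrix.sub_apply, Matrix.of_apply]
    split_ifs <;> simp
  rw [hDT, norm_sq_eq_matInner]
  have hTR : matInner T R = 0 := by
    have := matInner_projection_rectDiag (p₁ := p₁) (p₂ := p₂) Matrix.transpose_one
      (fun i => if i < s then σ i else 0) (fun i => if i < s then 0 else σ i)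
    rw [Matrix.one_mul] at this
    rw [this]
    refine Finset.sum_eq_zero fun i _ => ?_
    split_ifs <;> simp
  have hPTR : matInner (P * T) R = 0 := by
    rw [matInner_projection_rectDiag hPt]
    refine Finset.sum_eq_zero fun i _ => ?_
    split_ifs <;> simp
  have hPRR := matInner_projection_rectDiag (p₂ := p₂) hPt
    (fun i => if i < s then 0 else σ i) (fun i => if i < s then 0 else σ i)
  have hPTT := matInner_projection_rectDiag (p₂ := p₂) hPt
    (fun i => if i < s then σ i else 0) (fun i => if i < s then σ i else 0)
  have hTT := matInner_projection_rectDiag (p₁ := p₁) (p₂ := p₂) Matrix.transpose_one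
    (fun i => if i < s then σ i else 0) (fun i => if i < s then σ i else 0)
  rw [Matrix.one_mul] at hTT
  have hsum := sum_tail_le_sum_head (p₂ := p₂) hc hc1 hσ hanti hP0 hP1
    (show ∑ i, P i i ≤ c ^ 2 * s from (show ∑ i, P i i = P.trace from rfl) ▸ hPtr ▸ hw)
  simp only [sub_mul, Finset.sum_sub_distrib] at hsum
  simp only [Matrix.one_apply_eq] at hTT
  rw [← hPRR, ← hPTT, ← hTT, ← hT, ← hR] at hsum
  -- `hsum : ‖P R‖² ≤ c² ‖(1 - P) T‖²`; conclude by expanding `‖c (w - P T) - P R‖² ≥ 0`.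
  have hsq := matInner_self_nonneg (c • (w - P * T) - P * R)
  have e1 : ∀ A B : Matrix (Fin p₁) (Fin p₂) ℝ, matInner (P * A) (P * B) = matInner (P * A) B := by
    intro A B
    rw [matInner_comm, matInner_mul_left, hPt, ← Matrix.mul_assoc, hPP, matInner_comm]
  have e2 : ∀ B : Matrix (Fin p₁) (Fin p₂) ℝ, matInner w (P * B) = matInner w B := by
    intro B
    rw [matInner_comm, matInner_mul_left, hPt, hPw, matInner_comm]
  have e3 := matInner_comm (P * R) w
  have e4 := matInner_comm (P * T) w
  have hPRT : matInner (P * R) T = 0 := by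
    rw [matInner_mul_left, hPt, matInner_comm, hPTR]
  have e5 := matInner_comm T w
  simp only [matInner_sub_left, matInner_sub_right, matInner_smul_left, matInner_smul_right,
    e1, e2, e3, e4, e5, hPTR, hPRT, hTR] at hsq hsum ⊢
  have : c * (2 * matInner w R) ≤ c * (c * (matInner w w - matInner w T
      - (matInner w T - matInner T T))) := by nlinarith
  have := le_of_mul_le_mul_left this hc
  linarith

/-- Singular value truncation is a projection onto a nonconvex set, and `c` measures the failure of
the obtuse angle criterion `⟨w - Z, W - Z⟩ ≤ 0`, which would hold for a convex set. -/
lemma matInner_sub_truncation_le {c : ℝ} (hc : 0 < c) (hc1 : c ≤ 1) {s : ℕ}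
    {W Z w : Matrix (Fin p₁) (Fin p₂) ℝ} (hZ : IsSVDTruncation s W Z)
    (hw : (w.rank : ℝ) ≤ c ^ 2 * s) :
    matInner (w - Z) (W - Z) ≤ c / 2 * ‖w - Z‖ ^ 2 := by
  obtain ⟨U, σ, V, ⟨hU, hV, hσ, hanti, rfl⟩, rfl⟩ := hZ
  have hU' : U * Uᵀ = 1 := (Matrix.mem_orthogonalGroup_iff (Fin p₁) ℝ).1 hU
  have hV' : V * Vᵀ = 1 := (Matrix.mem_orthogonalGroup_iff (Fin p₂) ℝ).1 hV
  have hwUV : w = U * (Uᵀ * w * V) * Vᵀ := by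
    calc w = (U * Uᵀ) * w * (V * Vᵀ) := by rw [hU', hV', Matrix.one_mul, Matrix.mul_one]
      _ = _ := by simp only [Matrix.mul_assoc]
  have hrank : ((Uᵀ * w * V).rank : ℝ) ≤ c ^ 2 * s :=
    (Nat.cast_le.2 ((Matrix.rank_mul_le_left _ _).trans (Matrix.rank_mul_le_right _ _))).trans hw
  have h := matInner_sub_rectDiag_le hc hc1 hσ hanti hrank
  rw [norm_sq_eq_matInner] at h ⊢
  generalize Uᵀ * w * V = v at h hwUV
  subst hwUV
  simpa only [← Matrix.mul_sub, ← Matrix.sub_mul, matInner_orthogonal_conj hU hV] using h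

lemma IsSVDTruncation.rank_le {s : ℕ} {W Z : Matrix (Fin p₁) (Fin p₂) ℝ}
    (hZ : IsSVDTruncation s W Z) : Z.rank ≤ s := by
  obtain ⟨U, σ, V, -, rfl⟩ := hZ
  refine (Matrix.rank_mul_le_left _ _).trans ((Matrix.rank_mul_le_right _ _).trans ?_)
  have h : rectDiag p₁ p₂ (fun i => if i < s then σ i else 0)
      = Matrix.diagonal (fun i : Fin p₁ => if (i : ℕ) < s then (1 : ℝ) else 0)
        * rectDiag p₁ p₂ σ := by
    ext i j
    simp only [rectDiag, Matrix.diagonal_mul, Matrix.of_apply]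
    split_ifs <;> simp
  rw [h]
  refine (Matrix.rank_mul_le_left _ _).trans ?_
  rw [Matrix.rank_diagonal]
  have : Fintype.card {i : Fin p₁ // (if (i : ℕ) < s then (1 : ℝ) else 0) ≠ 0}
      ≤ Fintype.card (Fin s) :=
    Fintype.card_le_of_injective
      (fun i => ⟨i.1, by by_contra hi; exact i.2 (if_neg hi)⟩)
      fun i j hij => Subtype.ext (Fin.ext (Fin.mk.inj hij))
  simpa using this

/-! ### Convergence of the iteration -/

lemma IsPGD.rank_le {f : Matrix (Fin p₁) (Fin p₂) ℝ → ℝ} {s : ℕ} {η : ℝ}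
    {W : ℕ → Matrix (Fin p₁) (Fin p₂) ℝ} (hW : IsPGD f s η W) : ∀ t, (W t).rank ≤ s
  | 0 => by simp [hW.zero]
  | t + 1 => (hW.step t).rank_le

/-- One step of the iteration, from `x` to `y`, measured against a matrix `w` of rank at
most `r`. -/
lemma gap_step_le {f : Matrix (Fin p₁) (Fin p₂) ℝ → ℝ} {r s : ℕ} {α L : ℝ}
    {x y w : Matrix (Fin p₁) (Fin p₂) ℝ} (hα : 0 < α) (hαL : α ≤ L)
    (hC : RankRSC f (2 * s + r) α) (hS : RankRSS f (2 * s + r) L)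
    (hs : 32 * (L / α) ^ 2 * (r : ℝ) ≤ (s : ℝ)) (hw : w.rank ≤ r) (hx : x.rank ≤ s)
    (hy : IsSVDTruncation s (x - (2 / (3 * L)) • matGrad f x) y) :
    f y - f w ≤ 12 * (L / α) * (f x - f y) := by
  have hL : 0 < L := hα.trans_le hαL
  have hc0 : 0 < α / (5 * L) := by positivity
  have hc1 : α / (5 * L) ≤ 1 := by rw [div_le_one (by positivity)]; linarith
  have hrs : (w.rank : ℝ) ≤ (α / (5 * L)) ^ 2 * s := by
    have h1 : (w.rank : ℝ) ≤ r := by exact_mod_cast hw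
    have h2 : (α / (5 * L)) ^ 2 * (32 * (L / α) ^ 2 * r) ≤ (α / (5 * L)) ^ 2 * s :=
      mul_le_mul_of_nonneg_left hs (sq_nonneg _)
    have h3 : (α / (5 * L)) ^ 2 * (32 * (L / α) ^ 2 * r) = 32 / 25 * r := by
      field_simp
      ring
    have : (0 : ℝ) ≤ r := r.cast_nonneg
    linarith
  have hxx : (x.rank : ℝ) ≤ 1 ^ 2 * s := by
    rw [one_pow, one_mul]
    exact_mod_cast hx
  have hangle_w := matInner_sub_truncation_le hc0 hc1 hy hrs
  have hangle_x := matInner_sub_truncation_le one_pos le_rfl hy hxx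
  have hsmooth := hS s (s + r) (by ring) y x hy.rank_le (hx.trans (Nat.le_add_right _ _))
  have hconv := hC (s + r) s (by ring) w x (hw.trans (Nat.le_add_left _ _)) hx
  simp only [norm_sq_eq_matInner] at hangle_w hangle_x hsmooth hconv
  -- In terms of `a = x - y` and `b = w - y`, `x - w` is `a - b`.
  obtain ⟨a, rfl⟩ : ∃ a, x = a + y := ⟨x - y, by simp⟩
  obtain ⟨b, rfl⟩ : ∃ b, w = b + y := ⟨w - y, by simp⟩
  generalize matGrad f (a + y) = g at *
  have r1 : a + y - (2 / (3 * L)) • g - y = a - (2 / (3 * L)) • g := by abel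
  have r2 : y - (a + y) = 0 - a := by abel
  have r3 : b + y - (a + y) = b - a := by abel
  have hz : ∀ B : Matrix (Fin p₁) (Fin p₂) ℝ, matInner 0 B = 0 := by simp [matInner]
  have hz' : ∀ B : Matrix (Fin p₁) (Fin p₂) ℝ, matInner B 0 = 0 := by simp [matInner]
  rw [r1, add_sub_cancel_right] at hangle_w hangle_x
  rw [r2] at hsmooth
  rw [r3] at hconv
  simp only [matInner_sub_left, matInner_sub_right, matInner_smul_right, hz, hz',
    matInner_comm b a] at hangle_w hangle_x hsmooth hconv
  -- Young's inequality: `2 ⟨a, b⟩ ≥ - (3 L / α) ‖a‖² - (α / (3 L)) ‖b‖²`.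
  have hyoung := matInner_self_nonneg ((3 * L) • a - (-α) • b)
  simp only [matInner_sub_left, matInner_sub_right, matInner_smul_right, matInner_smul_left,
    matInner_comm b a] at hyoung
  have ha := matInner_self_nonneg a
  have hb := matInner_self_nonneg b
  generalize matInner a a = A at *
  generalize matInner b b = B at *
  generalize matInner a b = I at *
  generalize matInner a g = G at *
  generalize matInner b g = H at *
  have hG : 3 * L / 4 * A ≤ G := by
    have : 2 / (3 * L) * G = G / (3 * L / 2) := by field_simp
    rw [this] at hangle_x
    have h : A / 2 ≤ G / (3 * L / 2) := by linarith
    rw [le_div_iff₀ (by positivity)] at h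
    linarith
  have hH : 3 * L / 2 * I - 3 * α / 20 * B ≤ H := by
    have h1 : 2 / (3 * L) * H = H / (3 * L / 2) := by field_simp
    have h2 : α / (5 * L) / 2 * B = (3 * α / 20 * B) / (3 * L / 2) := by field_simp; ring
    rw [h1, h2] at hangle_w
    have h : I ≤ (3 * α / 20 * B + H) / (3 * L / 2) := by rw [add_div]; linarith
    rw [le_div_iff₀ (by positivity)] at h
    linarith
  have hdesc : L / 4 * A ≤ f (a + y) - f y := by linarith
  have hgap : α * (f y - f (b + y)) ≤ 3 * L ^ 2 * A := by
    have h1 : f y - f (b + y) ≤ (3 * L / 4 - α / 2) * (A - 2 * I + B)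
        - (3 * L / 4 - 3 * α / 20) * B := by
      have := mul_nonneg hL.le ha
      linarith
    -- Clear the denominator `3 L` of Young's inequality.
    have h2 : 3 * L * (α * (f y - f (b + y))) ≤ 3 * L * (3 * L ^ 2 * A) := by
      have h3 := mul_le_mul_of_nonneg_left h1 (mul_nonneg (by linarith : 0 ≤ 3 * L) hα.le)
      have h4 := mul_nonneg (by linarith : 0 ≤ 3 * L / 4 - α / 2) hyoung
      have h5 : 0 ≤ L * A := mul_nonneg hL.le ha
      have h6 : 0 ≤ α * B := mul_nonneg hα.le hb
      nlinarith [mul_nonneg (mul_nonneg hα.le h6) (sub_nonneg.2 hαL),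
        mul_nonneg (mul_nonneg hα.le h6) hL.le, mul_nonneg (mul_nonneg hα.le h6) hα.le,
        mul_nonneg (mul_nonneg hL.le h5) (sub_nonneg.2 hαL),
        mul_nonneg (mul_nonneg hα.le h5) (sub_nonneg.2 hαL),
        mul_nonneg (mul_nonneg hα.le h5) hL.le, mul_nonneg (mul_nonneg hα.le h5) hα.le]
    exact le_of_mul_le_mul_left h2 (by positivity)
  have hrhs : 12 * (L / α) * (f (a + y) - f y) = 12 * L * (f (a + y) - f y) / α := by ring
  rw [hrhs, le_div_iff₀ hα]
  nlinarith [mul_le_mul_of_nonneg_left hdesc hL.le]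

/-- Without `α ≤ L`, restricted convexity and smoothness leave room for a single matrix only. -/
lemma eq_of_lt_of_rank_le {f : Matrix (Fin p₁) (Fin p₂) ℝ → ℝ} {r s : ℕ} {α L : ℝ}
    {x w : Matrix (Fin p₁) (Fin p₂) ℝ} (hLα : L < α) (hC : RankRSC f (2 * s + r) α)
    (hS : RankRSS f (2 * s + r) L) (hw : w.rank ≤ r) (hx : x.rank ≤ s) : x = w := by
  have h1 := hC s (s + r) (by ring) x w hx (hw.trans (Nat.le_add_left _ _))
  have h2 := hS s (s + r) (by ring) x w hx (hw.trans (Nat.le_add_left _ _))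
  have h3 : ‖x - w‖ ^ 2 ≤ 0 := by
    by_contra h
    nlinarith [mul_pos (sub_pos.2 hLα) (not_le.1 h)]
  have h4 : ‖x - w‖ = 0 := pow_eq_zero_iff two_ne_zero |>.1 (le_antisymm h3 (sq_nonneg _))
  exact sub_eq_zero.1 (norm_eq_zero.1 h4)

/-- Linear convergence at a rate `1 - 1 / (1 + 12 κ)` in terms of the iteration count. -/
lemma le_of_geometric_decay {Δ : ℕ → ℝ} {κ ε : ℝ} (hκ : 1 ≤ κ) (hε : 0 < ε) (h0 : 0 ≤ Δ 0)
    (hstep : ∀ t, Δ (t + 1) ≤ 12 * κ * (Δ t - Δ (t + 1))) {τ : ℕ}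
    (hτ : 13 * κ * Real.log (Δ 0 / ε) ≤ τ) : Δ τ ≤ ε := by
  have hκ0 : 0 < κ := by linarith
  have hρ : 1 - 1 / (1 + 12 * κ) = 12 * κ / (1 + 12 * κ) := by field_simp; ring
  have hρ0 : 0 ≤ 1 - 1 / (1 + 12 * κ) := by rw [hρ]; positivity
  have hdecay : ∀ t, Δ t ≤ (1 - 1 / (1 + 12 * κ)) ^ t * Δ 0 := by
    intro t
    induction t with
    | zero => simp
    | succ t ih =>
      have h1 : Δ (t + 1) ≤ (1 - 1 / (1 + 12 * κ)) * Δ t := by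
        rw [hρ, div_mul_eq_mul_div, le_div_iff₀ (by positivity)]
        linarith [hstep t]
      calc Δ (t + 1) ≤ _ := h1
        _ ≤ (1 - 1 / (1 + 12 * κ)) * ((1 - 1 / (1 + 12 * κ)) ^ t * Δ 0) :=
          mul_le_mul_of_nonneg_left ih hρ0
        _ = _ := by ring
  rcases h0.eq_or_lt with h0 | h0
  · have := hdecay τ
    rw [← h0, mul_zero] at this
    linarith
  have hexp : 1 - 1 / (1 + 12 * κ) ≤ Real.exp (-(1 / (13 * κ))) := by
    have h1 : 1 / (13 * κ) ≤ 1 / (1 + 12 * κ) :=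
      one_div_le_one_div_of_le (by positivity) (by linarith)
    have h2 := Real.add_one_le_exp (-(1 / (13 * κ)))
    linarith
  have hlog : Real.log (Δ 0 / ε) ≤ τ * (1 / (13 * κ)) := by
    rw [mul_one_div, le_div_iff₀ (by positivity)]
    linarith
  have hratio : Δ 0 / ε ≤ Real.exp (τ * (1 / (13 * κ))) :=
    (Real.log_le_iff_le_exp (by positivity)).1 hlog
  rw [div_le_iff₀ hε] at hratio
  calc Δ τ ≤ _ := hdecay τ
    _ ≤ Real.exp (-(1 / (13 * κ))) ^ τ * Δ 0 :=
      mul_le_mul_of_nonneg_right (pow_le_pow_left₀ hρ0 hexp τ) h0.le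
    _ = Real.exp (-(τ * (1 / (13 * κ)))) * Δ 0 := by rw [← Real.exp_nat_mul]; ring_nf
    _ ≤ Real.exp (-(τ * (1 / (13 * κ)))) * (Real.exp (τ * (1 / (13 * κ))) * ε) :=
      mul_le_mul_of_nonneg_left hratio (Real.exp_pos _).le
    _ = ε := by rw [← mul_assoc, ← Real.exp_add, neg_add_cancel, Real.exp_zero, one_mul]

end LowRankPGD

theorem mainTheorem5 :
    ∃ C : ℝ, 0 < C ∧
      ∀ (p₁ p₂ : ℕ) (f : Matrix (Fin p₁) (Fin p₂) ℝ → ℝ) (r s : ℕ) (α L : ℝ)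
        (Wstar : Matrix (Fin p₁) (Fin p₂) ℝ) (W : ℕ → Matrix (Fin p₁) (Fin p₂) ℝ),
        Differentiable ℝ f → 0 < α → 0 < L →
        LowRankPGD.RankRSC f (2 * s + r) α →
        LowRankPGD.RankRSS f (2 * s + r) L →
        32 * (L / α) ^ 2 * (r : ℝ) ≤ (s : ℝ) →
        Wstar.rank ≤ r → (∀ Z : Matrix (Fin p₁) (Fin p₂) ℝ, Z.rank ≤ r → f Wstar ≤ f Z) →
        LowRankPGD.IsPGD f s (2 / (3 * L)) W →
        ∀ ε : ℝ, 0 < ε → ∀ τ : ℕ,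
          (C * (L / α) * Real.log ((f (W 0) - f Wstar) / ε) ≤ (τ : ℝ) →
            f (W τ) - f Wstar ≤ ε) ∧
          (0 ≤ f Wstar → C * (L / α) * Real.log (f (W 0) / ε) ≤ (τ : ℝ) →
            f (W τ) - f Wstar ≤ ε) := by

  refine ⟨13, by norm_num, ?_⟩
  intro p₁ p₂ f r s α L Wstar W _ hα hL hC hS hs hrank hmin hW ε hε τ
  by_cases hαL : α ≤ L
  · have hgap : 0 ≤ f (W 0) - f Wstar := by
      rw [sub_nonneg, hW.zero]
      exact hmin 0 (by simp)
    have hκ : 1 ≤ L / α := (one_le_div hα).2 hαL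
    have hmain : 13 * (L / α) * Real.log ((f (W 0) - f Wstar) / ε) ≤ τ →
        f (W τ) - f Wstar ≤ ε := by
      refine LowRankPGD.le_of_geometric_decay (Δ := fun t => f (W t) - f Wstar) hκ hε hgap
        fun t => ?_
      have h := LowRankPGD.gap_step_le hα hαL hC hS hs hrank (hW.rank_le t) (hW.step t)
      rwa [sub_sub_sub_cancel_right]
    refine ⟨hmain, fun hpos hτ => hmain ?_⟩
    rcases hgap.eq_or_lt with h0 | h0
    · -- With no initial gap, `Real.log 0 = 0` asks for no steps at all.
      rw [← h0, zero_div, Real.log_zero, mul_zero]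
      positivity
    · refine le_trans ?_ hτ
      gcongr
      linarith
  · have h := LowRankPGD.eq_of_lt_of_rank_le (not_le.1 hαL) hC hS hrank (hW.rank_le τ)
    rw [h, sub_self]
    exact ⟨fun _ => hε.le, fun _ _ => hε.le⟩
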